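/- Consider a memoryless half-duplex network with $N$ relays, indexed by $[1:N]$, one source and one destination. The inputs are $X_1,\dots,X_N$ (relays) and $X_{N+1}$ (source), the outputs are $Y_1,\dots,Y_N$ (relays) and $Y_{N+1}$ (destination), all with values in standard Borel alphabets, and $S=(S_1,\dots,S_N)\in\{0,1\}^N$ is the relay state ($S_k=0$: relay $k$ listens, $S_k=1$: relay $k$ transmits). The channel is given by a transition probability $P_{Y_{[1:N+1]}|X_{[1:N+1]},S}$ such that, when $S_k=0$, the outputs do not depend on $X_k$ and, when $S_k=1$, the output $Y_k$ is independent of all other random variables. Each relay chooses its pair $(X_k,S_k)$ at each time as a function of its own past outputs. Let $\mathsf C$ be the capacity in bits per channel use (average error probability tending to $0$, message uniformly distributed). A schedule is a probability mass function $\lambda=(\lambda_s)_{s\in\{0,1\}^N}$ on the $2^N$ states. Let the inputs be independent given the state, $P_{X_{[1:N+1]}|S}=\prod_{i=1}^{N+1}P_{X_i|S}$ (these distributions may be chosen depending on $\lambda$), and for $A\subseteq[1:N]$ and $s\in\{0,1\}^N$ let $$f_s(A)=I\big(X_{N+1},X_{A^c};\,Y_{N+1},Y_A\,\big|\,X_A,\,S=s\big)$$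 (in bits), where $A^c=[1:N]\setminus A$; these quantities are assumed to be finite. Assume that 1. the noises are independent: $P_{Y_{[1:N+1]}|X_{[1:N+1]},S}=\prod_{i=1}^{N+1}P_{Y_i|X_{[1:N+1]},S}$; 2. the values $f_s(A)$ do not depend on the schedule $\lambda$. Then the maximum $$\mathsf C'=\max_{\lambda}\ \min_{A\subseteq[1:N]}\ \sum_{s\in\{0,1\}^N}\lambda_s f_s(A)$$ over all schedules is attained by a schedule with at most $N+1$ nonzero entries. In particular, if $\mathsf C'-\mathsf G_1\le\mathsf C\le\mathsf C'+\mathsf G_2$ for some constants $\mathsf G_1,\mathsf G_2\ge 0$, that is, if independent inputs and a fixed schedule give the capacity to within constant gaps, then this schedule, with at most $N+1$ active states, already gives the capacity to within the same gaps. -/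

import Mathlib

open MeasureTheory ProbabilityTheory InformationTheory Filter
open scoped ENNReal

/-- The conditional mutual information `I(U; V | W)` in nats, for random variables with values in
standard Borel spaces: the relative entropy of the joint law `P_{W,U,V}` with respect to the law
`P_W × (P_{U|W} × P_{V|W})`, under which `U` and `V` are conditionally independent given `W`. -/
noncomputable def condMutualInfoNats {Ω α β γ : Type*} [MeasurableSpace Ω]
    [MeasurableSpace α] [StandardBorelSpace α] [Nonempty α]
    [MeasurableSpace β] [StandardBorelSpace β] [Nonempty β] [MeasurableSpace γ]
    (P : Measure Ω) [IsFiniteMeasure P] (U : Ω → α) (V : Ω → β) (W : Ω → γ) : ℝ≥0∞ :=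
  klDiv (P.map fun ω => (W ω, U ω, V ω))
    ((P.map W) ⊗ₘ ((condDistrib U W P) ×ₖ (condDistrib V W P)))

/-- The conditional mutual information `I(U; V | W)` in bits. -/
noncomputable def condMutualInfo {Ω α β γ : Type*} [MeasurableSpace Ω]
    [MeasurableSpace α] [StandardBorelSpace α] [Nonempty α]
    [MeasurableSpace β] [StandardBorelSpace β] [Nonempty β] [MeasurableSpace γ]
    (P : Measure Ω) [IsFiniteMeasure P] (U : Ω → α) (V : Ω → β) (W : Ω → γ) : ℝ≥0∞ :=
  condMutualInfoNats P U V W / ENNReal.ofReal (Real.log 2)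

/-- A relay state: `s k = false` if relay `k` listens, `s k = true` if it transmits. -/
abbrev RelayState (N : ℕ) : Type := Fin N → Bool

/-- A (fixed) schedule: a probability mass function `λ` on the `2 ^ N` relay states. -/
abbrev Schedule (N : ℕ) : Type := stdSimplex ℝ (RelayState N)

/-- The number of active states of a schedule, i.e. of states with nonzero probability. -/
noncomputable def Schedule.numActive {N : ℕ} (lam : Schedule N) : ℕ :=
  Set.ncard {s : RelayState N | lam.1 s ≠ 0}

/-- A memoryless half-duplex network with `N` relays.  The relays are the indices
`Fin.castSucc k`, `k : Fin N`; the index `Fin.last N` stands for the source in the family `X` of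
input alphabets and for the destination in the family `Y` of output alphabets. -/
structure HDRelayNetwork (N : ℕ) (X Y : Fin (N + 1) → Type*)
    [∀ i, MeasurableSpace (X i)] [∀ i, MeasurableSpace (Y i)] where
  /-- The transition probability `P_{Y | X, S}`. -/
  trans : Kernel ((∀ i, X i) × RelayState N) (∀ i, Y i)
  markov : IsMarkovKernel trans
  /-- While relay `k` listens, the outputs do not depend on its input. -/
  listen : ∀ (k : Fin N) (s : RelayState N), s k = false → ∀ x x' : (∀ i, X i),
    (∀ i, i ≠ k.castSucc → x i = x' i) → trans (x, s) = trans (x', s)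
  /-- While relay `k` transmits, its output is independent of all inputs, of the states of the
  other relays, and of all other outputs. -/
  transmit : ∀ k : Fin N, ∃ ν : Measure (Y k.castSucc),
    ∀ (x : ∀ i, X i) (s : RelayState N), s k = true →
      (trans (x, s)).map (fun y => y k.castSucc) = ν ∧
      IndepFun (fun y : (∀ i, Y i) => y k.castSucc)
        (({k.castSucc}ᶜ : Finset (Fin (N + 1))).restrict) (trans (x, s))

namespace HDRelayNetwork

variable {N : ℕ} {X Y : Fin (N + 1) → Type*}
  [∀ i, MeasurableSpace (X i)] [∀ i, MeasurableSpace (Y i)]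

instance (net : HDRelayNetwork N X Y) : IsMarkovKernel net.trans := net.markov

/-- The noises are independent: the outputs are conditionally independent given the inputs and
the state, `P_{Y | X, S} = ∏ i, P_{Y i | X, S}`. -/
def IndependentNoises (net : HDRelayNetwork N X Y) : Prop :=
  ∀ (x : ∀ i, X i) (s : RelayState N),
    net.trans (x, s) = Measure.pi fun i => (net.trans (x, s)).map fun y => y i

/-! ### Cuts -/

/-- The joint law of inputs and outputs in state `s`, when the inputs are independent with
marginals `p i`. -/
noncomputable def jointLaw (net : HDRelayNetwork N X Y) (p : ∀ i, ProbabilityMeasure (X i))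
    (s : RelayState N) : Measure ((∀ i, X i) × (∀ i, Y i)) :=
  (Measure.pi fun i => (p i : Measure (X i))) ⊗ₘ (net.trans.sectL s)

instance (net : HDRelayNetwork N X Y) (p : ∀ i, ProbabilityMeasure (X i)) (s : RelayState N) :
    IsProbabilityMeasure (net.jointLaw p s) := by
  unfold jointLaw; infer_instance

/-- The set `A` of relays, as a set of node indices. -/
def relayNodes (A : Finset (Fin N)) : Finset (Fin (N + 1)) := A.map Fin.castSuccEmb

/-- The value `f_s(A) = I(X_{N+1}, X_{Aᶜ}; Y_{N+1}, Y_A | X_A, S = s)` in bits of the cut `A` in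
state `s`, for independent inputs with marginals `p i`. -/
noncomputable def cutInfo [∀ i, StandardBorelSpace (X i)] [∀ i, Nonempty (X i)]
    [∀ i, StandardBorelSpace (Y i)] [∀ i, Nonempty (Y i)]
    (net : HDRelayNetwork N X Y) (p : ∀ i, ProbabilityMeasure (X i)) (s : RelayState N)
    (A : Finset (Fin N)) : ℝ≥0∞ :=
  condMutualInfo (net.jointLaw p s)
    (fun xy => ((relayNodes A)ᶜ).restrict xy.1)
    (fun xy => (insert (Fin.last N) (relayNodes A)).restrict xy.2)
    (fun xy => (relayNodes A).restrict xy.1)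

/-- `min_A ∑_s λ_s f_s(A)`, where the distribution of the input of node `i` in state `s` under the
schedule `λ` is `p λ s i`. -/
noncomputable def minCut [∀ i, StandardBorelSpace (X i)] [∀ i, Nonempty (X i)]
    [∀ i, StandardBorelSpace (Y i)] [∀ i, Nonempty (Y i)] (net : HDRelayNetwork N X Y)
    (p : Schedule N → RelayState N → ∀ i, ProbabilityMeasure (X i)) (lam : Schedule N) : ℝ :=
  Finset.univ.inf' Finset.univ_nonempty fun A : Finset (Fin N) =>
    ∑ s, lam.1 s * (net.cutInfo (p lam s) s A).toReal

/-! ### Capacity -/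

/-- A code with `M` messages.  At time `t = 0, 1, …` relay `k` chooses its input symbol and its
listen/transmit mode as a function of its `t` past outputs.  Only the times `t < n` are used. -/
structure Code (X Y : Fin (N + 1) → Type*) [∀ i, MeasurableSpace (X i)]
    [∀ i, MeasurableSpace (Y i)] (n M : ℕ) where
  source : Fin M → ℕ → X (Fin.last N)
  relay : ∀ (k : Fin N) (t : ℕ), (Fin t → Y k.castSucc) → X k.castSucc × Bool
  measurable_relay : ∀ k t, Measurable (relay k t)
  decoder : (Fin n → Y (Fin.last N)) → Fin M
  measurable_decoder : Measurable decoder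

namespace Code

variable {n M : ℕ}

/-- The channel input at time `t`, given the message and the outputs at times `0, …, t - 1`. -/
def input (c : Code X Y n M) (w : Fin M) (t : ℕ) (h : Fin t → ∀ i, Y i) :
    (∀ i, X i) × RelayState N :=
  (Fin.snoc (fun k => (c.relay k t fun j => h j k.castSucc).1) (c.source w t),
    fun k => (c.relay k t fun j => h j k.castSucc).2)

theorem measurable_input (c : Code X Y n M) (w : Fin M) (t : ℕ) : Measurable (c.input w t) := by
  have hm : ∀ k : Fin N, Measurable
      fun h : Fin t → ∀ i, Y i => c.relay k t fun j => h j k.castSucc := fun k =>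
    (c.measurable_relay k t).comp (by fun_prop)
  refine Measurable.prodMk (measurable_pi_lambda _ fun i => ?_)
    (measurable_pi_lambda _ fun k => (hm k).snd)
  induction i using Fin.lastCases with
  | last => simp
  | cast k => simpa using (hm k).fst

/-- The law of the outputs at times `0, …, t - 1`, given the message `w`: the channel is
memoryless, i.e. given the past it acts at time `t` on the current inputs only. -/
noncomputable def outputLaw (net : HDRelayNetwork N X Y) (c : Code X Y n M) (w : Fin M) :
    (t : ℕ) → Measure (Fin t → ∀ i, Y i)
  | 0 => Measure.dirac Fin.elim0
  | t + 1 => ((outputLaw net c w t) ⊗ₘ (net.trans.comap (c.input w t) (c.measurable_input w t))).map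
      fun hy => Fin.snoc (α := fun _ => ∀ i, Y i) hy.1 hy.2

/-- The probability that the decoded message is wrong, for a uniformly distributed message. -/
noncomputable def errorProb (net : HDRelayNetwork N X Y) (c : Code X Y n M) : ℝ :=
  (∑ w : Fin M, (c.outputLaw net w n).real
    {h | c.decoder (fun t => h t (Fin.last N)) ≠ w}) / M

end Code

/-- The rate `R` (in bits per channel use) is achievable: for each `ε > 0` and all large block
lengths `n`, there is a code with `⌈2 ^ (n R)⌉` messages and error probability at most `ε`. -/
def Achievable (net : HDRelayNetwork N X Y) (R : ℝ) : Prop :=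
  ∀ ε : ℝ, 0 < ε → ∀ᶠ n : ℕ in atTop,
    ∃ c : Code X Y n ⌈(2 : ℝ) ^ ((n : ℝ) * R)⌉₊, c.errorProb net ≤ ε

/-- The capacity, the supremum of the nonnegative achievable rates. -/
noncomputable def capacity (net : HDRelayNetwork N X Y) : EReal :=
  ⨆ (R : ℝ) (_ : 0 ≤ R ∧ net.Achievable R), (R : EReal)

end HDRelayNetwork

/-!
For a fixed state the cut values are submodular in the cut, and submodularity bounds the number of
active states of an extremal optimal schedule.

*Submodularity.* Compare the joint law of inputs and outputs with the law `productLaw`, under which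
all of them are independent with the same marginals, and let `D(T, U)` be the relative entropy of
the variables `X i`, `i ∈ T`, and `Y j`, `j ∈ U` (`nodeDiv`). As the inputs are independent,
`f_s(A)` is the mutual information between the inputs outside `A` and `(X_A, Y_A, Y_{N+1})`, and the
chain rule gives `f_s(A) log 2 = D(all, A ∪ {N+1}) - D(A, A ∪ {N+1})` (`nodeDiv_add_flow`). The
first term is a sum over the receiving nodes, because the noises are independent
(`nodeDiv_univ_eq_sum`). The second is supermodular, by the chain rule and data processing
(`nodeDiv_supermodular`). The subtraction makes sense since all terms are finite: a half-duplex
relay's output is independent of its own input, so that `D(all, {k})` is bounded by the value of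
the cut `{k}` (`nodeDiv_univ_singleton_ne_top`).

*Few active states.* If the optimum is `0`, every schedule is optimal. Otherwise let `λ` be an
extreme point of the compact set of optimal schedules. The
minimising cuts of the submodular function `∑ s, λ_s f_s` form a lattice, and each `f_s` with
`λ_s ≠ 0` is modular on it. A modular function on a lattice of subsets of `[1:N]` is determined by
its values on a maximal chain, that is, by at most `N + 1` values
(`exists_chain_determining_modular`). With more than `N + 1` active states there would be a nonzero
direction, supported on them, along which all minimising cuts keep their values. Moving along it
preserves the total mass, or else a small step and a normalisation would beat the optimum; but then
`λ` is interior to a segment of optimal schedules (`exists_sparse_maximin_of_submodular`).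
-/

/-! ### Modular functions and sparse maximin weights -/

/-- A modular function on a sublattice `L` of the subsets of `α` is determined by its values on a
maximal chain of `L`, which has at most `card α + 1` members. -/
theorem exists_chain_determining_modular {α : Type*} [Fintype α] [DecidableEq α]
    {L : Set (Finset α)} (hL : L.Nonempty) (hsup : ∀ A ∈ L, ∀ B ∈ L, A ∪ B ∈ L)
    (hinf : ∀ A ∈ L, ∀ B ∈ L, A ∩ B ∈ L) :
    ∃ C : Finset (Finset α), C.card ≤ Fintype.card α + 1 ∧ (∀ A ∈ C, A ∈ L) ∧
      ∀ h : Finset α → ℝ,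
        (∀ A ∈ L, ∀ B ∈ L, h (A ∪ B) + h (A ∩ B) = h A + h B) →
        (∀ A ∈ C, h A = 0) → ∀ A ∈ L, h A = 0 := by
  classical
  set M : Set L := maxChain (· ≤ ·)
  have hM : IsMaxChain (· ≤ ·) M := maxChain_spec
  -- by maximality, an element of `L` that is comparable to all of the chain lies in the chain
  have hmem : ∀ D : L, (∀ E ∈ M, D ≤ E ∨ E ≤ D) → D ∈ M := fun D hD => by
    rw [hM.2 (hM.1.insert fun E hE _ => hD E hE) (Set.subset_insert D M)]
    exact Set.mem_insert D M
  have htot : ∀ D ∈ M, ∀ E ∈ M, D ≤ E ∨ E ≤ D := fun D hD E hE => hM.1.total hD hE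
  refine ⟨M.toFinset.map (Function.Embedding.subtype _), ?_, ?_, ?_⟩
  · rw [Finset.card_map, ← Finset.card_range (Fintype.card α + 1)]
    refine Finset.card_le_card_of_injOn (fun D => D.1.card)
      (fun D _ => by simpa [Nat.lt_succ_iff] using Finset.card_le_univ D.1) ?_
    intro D hD E hE hDE
    rcases htot D (by simpa using hD) E (by simpa using hE) with h | h
    · exact Subtype.ext (Finset.eq_of_subset_of_card_le h hDE.ge)
    · exact Subtype.ext (Finset.eq_of_subset_of_card_le h hDE.le).symm
  · intro A hA
    obtain ⟨D, -, rfl⟩ := Finset.mem_map.1 hA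
    exact D.2
  · intro h hmod hzero
    have hz : ∀ D ∈ M, h D.1 = 0 := fun D hD =>
      hzero _ (Finset.mem_map.2 ⟨D, by simpa using hD, rfl⟩)
    -- climbing the chain from below, `h` vanishes at the traces of `A` on its members
    have key : ∀ n : ℕ, ∀ D ∈ M, D.1.card = n → ∀ A ∈ L, h (A ∩ D.1) = 0 := by
      intro n
      induction n using Nat.strong_induction_on with
      | _ n ih =>
        intro D hD hn A hA
        by_cases hbelow : (M.toFinset.filter fun E => E < D).Nonempty
        · obtain ⟨E, hE, hEmax⟩ := Finset.exists_max_image _ (fun E : L => E.1.card) hbelow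
          simp only [Finset.mem_filter, Set.mem_toFinset] at hE hEmax
          have hED : E.1 ⊆ D.1 := hE.2.le
          have hAE : h (A ∩ E.1) = 0 :=
            ih _ (hn ▸ Finset.card_lt_card hE.2) E hE.1 rfl A hA
          let F : L := ⟨A ∩ D.1 ∪ E.1, hsup _ (hinf A hA _ D.2) _ E.2⟩
          have hFD : F ≤ D := Finset.union_subset Finset.inter_subset_right hED
          have hEF : E ≤ F := Finset.subset_union_right
          have hF : F ∈ M := by
            refine hmem F fun G hG => ?_
            rcases htot D hD G hG with hDG | hGD
            · exact Or.inl (hFD.trans hDG)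
            rcases hGD.eq_or_lt with rfl | hlt
            · exact Or.inl hFD
            rcases htot E hE.1 G hG with hEG | hGE
            · have hGE : G = E :=
                Subtype.ext (Finset.eq_of_subset_of_card_le hEG (hEmax G ⟨hG, hlt⟩)).symm
              exact Or.inr (hGE ▸ hEF)
            · exact Or.inr (hGE.trans hEF)
          rcases hFD.eq_or_lt with hFD | hFD
          · have h1 := hmod _ (hinf A hA _ D.2) _ E.2
            have h2 : A ∩ D.1 ∪ E.1 = D.1 := congrArg Subtype.val hFD
            rw [h2, Finset.inter_assoc, Finset.inter_eq_right.2 hED, hAE, hz D hD,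
              hz E hE.1] at h1
            linarith
          · have h1 : E.1 = F.1 := Finset.eq_of_subset_of_card_le hEF (hEmax F ⟨hF, hFD⟩)
            have h2 : A ∩ D.1 ⊆ E.1 := h1 ▸ Finset.subset_union_left
            have h3 : A ∩ D.1 = A ∩ E.1 :=
              (Finset.subset_inter Finset.inter_subset_left h2).antisymm
                (Finset.inter_subset_inter_left hED)
            rw [h3, hAE]
        · let F : L := ⟨A ∩ D.1, hinf A hA _ D.2⟩
          have hFD : F ≤ D := Finset.inter_subset_right
          have hDmin : ∀ G ∈ M, D ≤ G := fun G hG => by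
            rcases htot D hD G hG with hDG | hGD
            · exact hDG
            · rcases hGD.eq_or_lt with rfl | hlt
              · exact le_rfl
              · exact absurd ⟨G, by simpa using ⟨hG, hlt⟩⟩ hbelow
          have hF : F ∈ M := hmem F fun G hG => Or.inl (hFD.trans (hDmin G hG))
          exact hz F hF
    intro A hA
    have hne : M.toFinset.Nonempty := by
      by_contra hemp
      rw [Finset.not_nonempty_iff_eq_empty, Set.toFinset_eq_empty] at hemp
      obtain ⟨B, hB⟩ := hL
      have := hmem ⟨B, hB⟩ (by simp [hemp])
      simp [hemp] at this
    obtain ⟨D, hD, hDmax⟩ := Finset.exists_max_image _ (fun E : L => E.1.card) hne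
    simp only [Set.mem_toFinset] at hD hDmax
    have hDtop : ∀ G ∈ M, G ≤ D := fun G hG => by
      rcases htot D hD G hG with hDG | hGD
      · exact (Subtype.ext (Finset.eq_of_subset_of_card_le hDG (hDmax G hG))).ge
      · exact hGD
    let F : L := ⟨A ∪ D.1, hsup A hA _ D.2⟩
    have hDF : D ≤ F := Finset.subset_union_right
    have hF : F ∈ M := hmem F fun G hG => Or.inr ((hDtop G hG).trans hDF)
    have hAD : A ⊆ D.1 := Finset.subset_union_left.trans (hDtop F hF)
    rw [← Finset.inter_eq_left.2 hAD]
    exact key _ D hD rfl A hA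

/-- The maximum of `min_A ∑ s, mu s * f s A` over probability vectors `mu` is attained at a vector
with at most `card α + 1` nonzero entries, if all `f s` are nonnegative and submodular.

If the maximum is positive, an extreme point `lam` of the set of maximisers is such a
vector. The tight sets `A` are the
minimisers of a submodular function, hence a lattice, on which every `f s` with `lam s ≠ 0` is
modular; thus the equations `∑ s, d s * f s A = 0`, `A` tight, in a direction `d` supported on the
support of `lam`, follow from `card α + 1` of them. -/
theorem exists_sparse_maximin_of_submodular {ι α : Type*} [Fintype ι] [Nonempty ι] [Fintype α]
    [DecidableEq α] (f : ι → Finset α → ℝ) (hf0 : ∀ s A, 0 ≤ f s A)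
    (hsub : ∀ s A B, f s (A ∪ B) + f s (A ∩ B) ≤ f s A + f s B) :
    ∃ lam ∈ stdSimplex ℝ ι, {s | lam s ≠ 0}.ncard ≤ Fintype.card α + 1 ∧
      ∀ mu ∈ stdSimplex ℝ ι,
        (Finset.univ.inf' Finset.univ_nonempty fun A : Finset α => ∑ s, mu s * f s A) ≤
        Finset.univ.inf' Finset.univ_nonempty fun A : Finset α => ∑ s, lam s * f s A := by
  classical
  set g : (ι → ℝ) → ℝ := fun mu =>
    Finset.univ.inf' Finset.univ_nonempty fun A : Finset α => ∑ s, mu s * f s A with hg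
  have hgc : Continuous g :=
    Continuous.finset_inf'_apply _ fun A _ => by fun_prop
  have hle : ∀ mu c, c ≤ g mu ↔ ∀ A, c ≤ ∑ s, mu s * f s A := fun mu c => by
    simp [hg, Finset.le_inf'_iff]
  have hcpt : IsCompact (stdSimplex ℝ ι) := isCompact_stdSimplex ℝ ι
  obtain ⟨i₀⟩ := ‹Nonempty ι›
  have hsingle : Pi.single i₀ (1 : ℝ) ∈ stdSimplex ℝ ι := single_mem_stdSimplex ℝ i₀
  obtain ⟨lam₀, hlam₀, hmax⟩ := hcpt.exists_isMaxOn ⟨_, hsingle⟩ hgc.continuousOn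
  set v := g lam₀ with hv
  have hmax' : ∀ mu ∈ stdSimplex ℝ ι, g mu ≤ v := fun mu hmu => hmax hmu
  rcases le_or_gt v 0 with hv0 | hv0
  · -- if the value is zero, every schedule is optimal
    refine ⟨_, hsingle, ?_, fun mu hmu => (hmax' mu hmu).trans (hv0.trans ?_)⟩
    · refine (Set.ncard_le_ncard (t := {i₀}) (fun s hs => ?_)).trans (by simp)
      by_contra hne
      exact hs (Pi.single_eq_of_ne hne 1)
    · exact (hle _ 0).2 fun A => Finset.sum_nonneg fun s _ => mul_nonneg (hsingle.1 s) (hf0 s A)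
  set O : Set (ι → ℝ) := stdSimplex ℝ ι ∩ {mu | v ≤ g mu} with hO
  have hOc : IsCompact O := hcpt.inter_right (isClosed_le continuous_const hgc)
  obtain ⟨lam, hlam⟩ := hOc.extremePoints_nonempty ⟨lam₀, hlam₀, hv.le⟩
  obtain ⟨⟨hlamS, hlamv⟩, hext⟩ := hlam
  refine ⟨lam, hlamS, ?_, fun mu hmu => (hmax' mu hmu).trans hlamv⟩
  have hval : g lam = v := le_antisymm (hmax' lam hlamS) hlamv
  by_contra hcard
  push Not at hcard
  -- the tight cuts form a lattice, on which each active `f s` is modular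
  set L : Set (Finset α) := {A | ∑ s, lam s * f s A = v} with hLdef
  have hge : ∀ A, v ≤ ∑ s, lam s * f s A := (hle lam v).1 hlamv
  have hdefect : ∀ A ∈ L, ∀ B ∈ L,
      (∑ s, lam s * f s (A ∪ B) = v ∧ ∑ s, lam s * f s (A ∩ B) = v) ∧
      ∀ s, lam s ≠ 0 → f s (A ∪ B) + f s (A ∩ B) = f s A + f s B := by
    intro A hA B hB
    have hA : ∑ s, lam s * f s A = v := hA
    have hB : ∑ s, lam s * f s B = v := hB
    have hnn : ∀ s, 0 ≤ lam s * (f s A + f s B - (f s (A ∪ B) + f s (A ∩ B))) := fun s =>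
      mul_nonneg (hlamS.1 s) (by linarith [hsub s A B])
    have hsum : ∑ s, lam s * (f s A + f s B - (f s (A ∪ B) + f s (A ∩ B))) =
        v + v - (∑ s, lam s * f s (A ∪ B) + ∑ s, lam s * f s (A ∩ B)) := by
      simp only [mul_sub, mul_add, Finset.sum_sub_distrib, Finset.sum_add_distrib, hA, hB]
    have h0 := Finset.sum_nonneg fun s (_ : s ∈ Finset.univ) => hnn s
    have h1 := hge (A ∪ B)
    have h2 := hge (A ∩ B)
    refine ⟨⟨by linarith, by linarith⟩, fun s hs => ?_⟩
    have hz := (Finset.sum_eq_zero_iff_of_nonneg fun s (_ : s ∈ Finset.univ) => hnn s).1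
      (by linarith) s (Finset.mem_univ s)
    rcases mul_eq_zero.1 hz with h | h
    · exact absurd h hs
    · linarith
  have hLne : L.Nonempty := by
    obtain ⟨A, -, hA⟩ := Finset.exists_mem_eq_inf' Finset.univ_nonempty
      fun A : Finset α => ∑ s, lam s * f s A
    exact ⟨A, hA.symm.trans hval⟩
  obtain ⟨C, hCcard, -, hC⟩ := exists_chain_determining_modular hLne
    (fun A hA B hB => (hdefect A hA B hB).1.1) (fun A hA B hB => (hdefect A hA B hB).1.2)
  -- more active states than chain members: a direction in which no tight cut changes its value
  obtain ⟨d, hd0, hdne, hdC⟩ : ∃ d : ι → ℝ, (∀ s, lam s = 0 → d s = 0) ∧ d ≠ 0 ∧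
      ∀ A ∈ C, ∑ s, d s * f s A = 0 := by
    let T : ({s // lam s ≠ 0} → ℝ) →ₗ[ℝ] (C → ℝ) :=
      LinearMap.pi fun A => ∑ s, f s.1 A.1 • LinearMap.proj s
    have hlt : Module.finrank ℝ (C → ℝ) < Module.finrank ℝ ({s // lam s ≠ 0} → ℝ) := by
      have : Fintype.card {s // lam s ≠ 0} = {s | lam s ≠ 0}.ncard := by
        rw [← Nat.card_coe_set_eq, Nat.card_eq_fintype_card]; rfl
      simp only [Module.finrank_fintype_fun_eq_card, Fintype.card_coe, this]
      omega
    obtain ⟨x, hx, hxne⟩ :=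
      (Submodule.ne_bot_iff _).1 (LinearMap.ker_ne_bot_of_finrank_lt hlt (f := T))
    refine ⟨fun s => if h : lam s ≠ 0 then x ⟨s, h⟩ else 0, fun s hs => by simp [hs], ?_, ?_⟩
    · intro h
      refine hxne (funext fun s => ?_)
      simpa [s.2] using congrFun h s.1
    · intro A hA
      have hxA : ∑ s : {s // lam s ≠ 0}, f s.1 A * x s = 0 := by
        simpa [T] using congrFun (LinearMap.mem_ker.1 hx) ⟨A, hA⟩
      refine Eq.trans ?_ hxA
      refine (Fintype.sum_of_injective Subtype.val Subtype.val_injective _ _ (fun s hs => ?_)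
        fun s => ?_).symm
      · have : lam s = 0 := by simpa using hs
        simp [this]
      · simp [s.2, mul_comm]
  have hdL : ∀ A ∈ L, ∑ s, d s * f s A = 0 := by
    refine hC (fun A => ∑ s, d s * f s A) (fun A hA B hB => ?_) hdC
    simp only [← Finset.sum_add_distrib, ← mul_add]
    refine Finset.sum_congr rfl fun s _ => ?_
    by_cases hs : lam s = 0
    · simp [hd0 s hs]
    · rw [(hdefect A hA B hB).2 s hs]
  set σ := ∑ s, d s with hσ
  -- small steps along `d` keep the entries nonnegative and all cuts at `v` or above
  have hev : ∀ᶠ t : ℝ in nhds 0, (∀ s, 0 ≤ lam s + t * d s) ∧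
      ∀ A, v ≤ ∑ s, (lam s + t * d s) * f s A := by
    refine (eventually_all.2 fun s => ?_).and (eventually_all.2 fun A => ?_)
    · by_cases hs : lam s = 0
      · simp [hs, hd0 s hs]
      · have hc : Continuous fun t : ℝ => lam s + t * d s := by fun_prop
        have : ∀ᶠ t : ℝ in nhds 0, 0 < lam s + t * d s :=
          hc.continuousAt.eventually_const_lt
            (by simpa using lt_of_le_of_ne (hlamS.1 s) (Ne.symm hs))
        exact this.mono fun t ht => ht.le
    · by_cases hA : A ∈ L
      · refine Eventually.of_forall fun t => ?_
        have hA' : ∑ s, lam s * f s A = v := hA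
        simp only [add_mul, Finset.sum_add_distrib, mul_assoc, ← Finset.mul_sum, hdL A hA, hA']
        simp
      · have hc : Continuous fun t : ℝ => ∑ s, (lam s + t * d s) * f s A := by fun_prop
        have : ∀ᶠ t : ℝ in nhds 0, v < ∑ s, (lam s + t * d s) * f s A :=
          hc.continuousAt.eventually_const_lt
            (by simpa using lt_of_le_of_ne (hge A) (Ne.symm hA))
        exact this.mono fun t ht => ht.le
  have hsumt : ∀ t : ℝ, ∑ s, (lam s + t * d s) = 1 + t * σ := fun t => by
    rw [Finset.sum_add_distrib, ← Finset.mul_sum, hlamS.2]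
  -- a step that lowers the total mass would, after normalisation, beat the optimal value
  have hσ0 : ∀ᶠ t : ℝ in nhds 0, 0 ≤ t * σ := by
    have hpos : ∀ᶠ t : ℝ in nhds 0, 0 < 1 + t * σ :=
      (show Continuous fun t : ℝ => 1 + t * σ by fun_prop).continuousAt.eventually_const_lt
        (by simp)
    filter_upwards [hev, hpos] with t ⟨ht1, ht2⟩ ht3
    by_contra! hneg
    have hmem : (fun s => (lam s + t * d s) / (1 + t * σ)) ∈ stdSimplex ℝ ι :=
      ⟨fun s => div_nonneg (ht1 s) ht3.le, by rw [← Finset.sum_div, hsumt, div_self ht3.ne']⟩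
    have h1 : v / (1 + t * σ) ≤ v := by
      refine le_trans ((hle _ _).2 fun A => ?_) (hmax' _ hmem)
      simp only [div_mul_eq_mul_div, ← Finset.sum_div]
      exact div_le_div_of_nonneg_right (ht2 A) ht3.le
    rw [div_le_iff₀ ht3] at h1
    nlinarith
  obtain ⟨ε, hε, hball⟩ := Metric.eventually_nhds_iff.1 (hev.and hσ0)
  have hp := hball (y := ε / 2) (by simp [abs_of_pos hε, hε])
  have hm := hball (y := -(ε / 2)) (by simp [abs_of_pos hε, hε])
  have hσz : σ = 0 := by
    have h1 := hp.2
    have h2 := hm.2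
    nlinarith
  have hinO : ∀ t : ℝ, ((∀ s, 0 ≤ lam s + t * d s) ∧ ∀ A, v ≤ ∑ s, (lam s + t * d s) * f s A) →
      (fun s => lam s + t * d s) ∈ O := fun t ht =>
    ⟨⟨ht.1, by rw [hsumt, hσz]; simp⟩, (hle _ _).2 ht.2⟩
  have heq := hext (hinO _ hp.1) (hinO _ hm.1)
    ⟨1 / 2, 1 / 2, by norm_num, by norm_num, by norm_num, by
      ext s; simp; ring⟩
  refine hdne (funext fun s => ?_)
  have := congrFun heq s
  simp only [Pi.zero_apply] at this ⊢
  have h3 : ε / 2 * d s = 0 := by linarith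
  rcases mul_eq_zero.1 h3 with h | h
  · linarith
  · exact h

/-! ### Relative entropy and conditional mutual information -/

section Divergence

variable {Ω α β γ δ : Type*} [MeasurableSpace Ω] [MeasurableSpace α] [MeasurableSpace β]
  [MeasurableSpace γ] [MeasurableSpace δ] {P R : Measure Ω} [IsProbabilityMeasure P]
  [IsProbabilityMeasure R]

theorem klDiv_map_comp_le {V : Ω → α} (hV : Measurable V) {g : α → β} (hg : Measurable g) :
    klDiv (P.map fun ω => g (V ω)) (R.map fun ω => g (V ω)) ≤ klDiv (P.map V) (R.map V) := by
  have h := klDiv_map_le (P.map V) (R.map V) hg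
  rwa [Measure.map_map hg hV, Measure.map_map hg hV] at h

/-- Chain rule of the relative entropy for a pair that is independent under the reference measure.
The last term is a mutual information if `U` has the same law under `P` and `R`. -/
theorem klDiv_map_prodMk_of_indepFun [StandardBorelSpace β] [Nonempty β] {V : Ω → α} {U : Ω → β}
    (hV : Measurable V) (hU : Measurable U) (h : IndepFun V U R) :
    klDiv (P.map fun ω => (V ω, U ω)) (R.map fun ω => (V ω, U ω)) =
      klDiv (P.map V) (R.map V) +
        klDiv (P.map fun ω => (V ω, U ω)) ((P.map V).prod (R.map U)) := by
  have := Measure.isProbabilityMeasure_map (μ := P) hV.aemeasurable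
  have := Measure.isProbabilityMeasure_map (μ := R) hV.aemeasurable
  have := Measure.isProbabilityMeasure_map (μ := R) hU.aemeasurable
  rw [(indepFun_iff_map_prod_eq_prod_map_map hV.aemeasurable hU.aemeasurable).1 h,
    ← compProd_map_condDistrib hU.aemeasurable, ← Measure.compProd_const,
    ← Measure.compProd_const, klDiv_compProd_eq_add]

theorem klDiv_map_prodMk_prod_le {V : Ω → α} (hV : Measurable V) {U : Ω → β} (hU : Measurable U)
    {g : α → γ} (hg : Measurable g) (ρ : Measure β) [IsProbabilityMeasure ρ] :
    klDiv (P.map fun ω => (g (V ω), U ω)) ((P.map fun ω => g (V ω)).prod ρ) ≤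
      klDiv (P.map fun ω => (V ω, U ω)) ((P.map V).prod ρ) := by
  have := Measure.isProbabilityMeasure_map (μ := P) hV.aemeasurable
  have h := klDiv_map_le (P.map fun ω => (V ω, U ω)) ((P.map V).prod ρ)
    (hg.prodMap measurable_id)
  rwa [Measure.map_map (hg.prodMap measurable_id) (hV.prodMk hU),
    ← Measure.map_prod_map _ _ hg measurable_id, Measure.map_id, Measure.map_map hg hV] at h

/-- Relative entropy to a law under which the variables are independent is supermodular in the
set of variables: by the chain rule, adding `V₃` to `(V₁, V₂)` increases it by a divergence of which
the increase from adding `V₃` to `V₁` is a marginal. -/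
theorem klDiv_supermodular [StandardBorelSpace γ] [Nonempty γ] {V₁ : Ω → α} {V₂ : Ω → β}
    {V₃ : Ω → γ} (h₁ : Measurable V₁) (h₂ : Measurable V₂) (h₃ : Measurable V₃)
    (h : IndepFun (fun ω => (V₁ ω, V₂ ω)) V₃ R) :
    klDiv (P.map fun ω => (V₁ ω, V₂ ω)) (R.map fun ω => (V₁ ω, V₂ ω)) +
        klDiv (P.map fun ω => (V₁ ω, V₃ ω)) (R.map fun ω => (V₁ ω, V₃ ω)) ≤
      klDiv (P.map fun ω => ((V₁ ω, V₂ ω), V₃ ω)) (R.map fun ω => ((V₁ ω, V₂ ω), V₃ ω)) +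
        klDiv (P.map V₁) (R.map V₁) := by
  have := Measure.isProbabilityMeasure_map (μ := R) h₃.aemeasurable
  have h' : IndepFun V₁ V₃ R := h.comp measurable_fst measurable_id
  rw [klDiv_map_prodMk_of_indepFun (h₁.prodMk h₂) h₃ h, klDiv_map_prodMk_of_indepFun h₁ h₃ h',
    add_assoc, add_comm (klDiv (P.map V₁) _)]
  gcongr
  exact klDiv_map_prodMk_prod_le (h₁.prodMk h₂) h₃ measurable_fst _

/-- The divergence of two kernels that read only the first coordinate, averaged over `μ`, depends
on `μ` only through its first marginal. -/
theorem klDiv_compProd_prodMkRight [StandardBorelSpace β] [Nonempty β] (μ : Measure (α × β))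
    [IsProbabilityMeasure μ] (κ η : Kernel α γ) [IsMarkovKernel κ] [IsMarkovKernel η] :
    klDiv (μ ⊗ₘ κ.prodMkRight β) (μ ⊗ₘ η.prodMkRight β) = klDiv (μ.fst ⊗ₘ κ) (μ.fst ⊗ₘ η) := by
  -- exchange the last two coordinates, so that the common kernel `μ.condKernel` comes last
  have key : ∀ (θ : Kernel α γ) [IsMarkovKernel θ], (μ ⊗ₘ θ.prodMkRight β).map
      (fun p : (α × β) × γ => ((p.1.1, p.2), p.1.2)) =
        (μ.fst ⊗ₘ θ) ⊗ₘ μ.condKernel.prodMkRight γ := by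
    intro θ _
    refine Measure.ext_of_lintegral _ fun f hf => ?_
    rw [lintegral_map hf (by fun_prop), Measure.lintegral_compProd (by fun_prop),
      Measure.lintegral_compProd hf, Measure.lintegral_compProd (by fun_prop)]
    conv_lhs => rw [← μ.disintegrate μ.condKernel]
    rw [Measure.lintegral_compProd (by fun_prop)]
    refine lintegral_congr fun a => ?_
    simp only [Kernel.prodMkRight_apply]
    exact lintegral_lintegral_swap (by fun_prop)
  have hswap : Measurable fun p : (α × β) × γ => ((p.1.1, p.2), p.1.2) := by fun_prop
  have hswap' : Measurable fun p : (α × γ) × β => ((p.1.1, p.2), p.1.2) := by fun_prop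
  rw [← klDiv_compProd_left (μ.fst ⊗ₘ κ) (μ.fst ⊗ₘ η) (μ.condKernel.prodMkRight γ), ← key, ← key]
  refine le_antisymm ?_ (klDiv_map_le _ _ hswap)
  have h := klDiv_map_le ((μ ⊗ₘ κ.prodMkRight β).map fun p => ((p.1.1, p.2), p.1.2))
    ((μ ⊗ₘ η.prodMkRight β).map fun p => ((p.1.1, p.2), p.1.2)) hswap'
  rw [Measure.map_map hswap' hswap, Measure.map_map hswap' hswap] at h
  simpa [Function.comp_def] using h

/-- If `V₂` and `V₃` are conditionally independent given `V₁` under `P` (the law of `V₃` given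
`(V₁, V₂)` being `κ V₁`), then their contributions to the divergence add up. -/
theorem klDiv_map_add_of_compProd [StandardBorelSpace β] [Nonempty β] [StandardBorelSpace γ]
    [Nonempty γ] {V₁ : Ω → α} {V₂ : Ω → β} {V₃ : Ω → γ} (h₁ : Measurable V₁) (h₂ : Measurable V₂)
    (h₃ : Measurable V₃) (κ : Kernel α γ) [IsMarkovKernel κ]
    (hP : P.map (fun ω => ((V₁ ω, V₂ ω), V₃ ω)) =
      P.map (fun ω => (V₁ ω, V₂ ω)) ⊗ₘ κ.prodMkRight β)
    (h : IndepFun (fun ω => (V₁ ω, V₂ ω)) V₃ R) (hV₁ : P.map V₁ = R.map V₁) :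
    klDiv (P.map fun ω => ((V₁ ω, V₂ ω), V₃ ω)) (R.map fun ω => ((V₁ ω, V₂ ω), V₃ ω)) =
      klDiv (P.map fun ω => (V₁ ω, V₂ ω)) (R.map fun ω => (V₁ ω, V₂ ω)) +
        klDiv (P.map fun ω => (V₁ ω, V₃ ω)) (R.map fun ω => (V₁ ω, V₃ ω)) := by
  have := Measure.isProbabilityMeasure_map (μ := R) h₃.aemeasurable
  have := Measure.isProbabilityMeasure_map (μ := R) h₁.aemeasurable
  have := Measure.isProbabilityMeasure_map (μ := P) (h₁.prodMk h₂).aemeasurable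
  have h13 : IndepFun V₁ V₃ R := h.comp measurable_fst measurable_id
  have hfst : (P.map fun ω => (V₁ ω, V₂ ω)).fst = P.map V₁ := Measure.fst_map_prodMk h₂
  -- marginalising `V₂` in the hypothesis
  have hP13 : P.map (fun ω => (V₁ ω, V₃ ω)) = P.map V₁ ⊗ₘ κ := by
    have := congrArg (Measure.map fun p : (α × β) × γ => (p.1.1, p.2)) hP
    rw [Measure.map_map (by fun_prop) ((h₁.prodMk h₂).prodMk h₃)] at this
    refine this.trans (Measure.ext_of_lintegral _ fun f hf => ?_)
    rw [lintegral_map hf (by fun_prop), Measure.lintegral_compProd (by fun_prop),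
      Measure.lintegral_compProd hf, lintegral_map (by fun_prop) (h₁.prodMk h₂),
      lintegral_map (by fun_prop) h₁]
    rfl
  have hconst : (Kernel.const α (R.map V₃)).prodMkRight β = Kernel.const (α × β) (R.map V₃) := rfl
  rw [klDiv_map_prodMk_of_indepFun (h₁.prodMk h₂) h₃ h, klDiv_map_prodMk_of_indepFun h₁ h₃ h13,
    ← Measure.compProd_const, ← Measure.compProd_const, hP, ← hconst,
    klDiv_compProd_prodMkRight, hfst, hP13, hV₁, klDiv_self, zero_add]

/-- For independent `U` and `W`, one has `I(U; V | W) = I(U; W, V)`. -/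
theorem condMutualInfoNats_of_indepFun [StandardBorelSpace α] [Nonempty α] [StandardBorelSpace β]
    [Nonempty β] {U : Ω → α} {V : Ω → β} {W : Ω → γ} (hU : Measurable U) (hV : Measurable V)
    (hW : Measurable W) (h : IndepFun W U P) :
    condMutualInfoNats P U V W =
      klDiv (P.map fun ω => ((W ω, V ω), U ω)) ((P.map fun ω => (W ω, V ω)).prod (P.map U)) := by
  have := Measure.isProbabilityMeasure_map (μ := P) hU.aemeasurable
  have := Measure.isProbabilityMeasure_map (μ := P) hW.aemeasurable
  have := Measure.isProbabilityMeasure_map (μ := P) (hW.prodMk hV).aemeasurable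
  have hconst : condDistrib U W P =ᵐ[P.map W] Kernel.const γ (P.map U) :=
    condDistrib_ae_eq_of_measure_eq_compProd _ hU.aemeasurable (by
      rw [Measure.compProd_const]
      exact (indepFun_iff_map_prod_eq_prod_map_map hW.aemeasurable hU.aemeasurable).1 h)
  have hre : Measurable fun p : γ × α × β => ((p.1, p.2.2), p.2.1) := by fun_prop
  have hre' : Measurable fun p : (γ × β) × α => (p.1.1, p.2, p.1.2) := by fun_prop
  have href : ((P.map fun ω => (W ω, V ω)).prod (P.map U)).map (fun p => (p.1.1, p.2, p.1.2)) =
      (P.map W) ⊗ₘ ((condDistrib U W P) ×ₖ (condDistrib V W P)) := by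
    refine Measure.ext_of_lintegral _ fun f hf => ?_
    rw [lintegral_map hf hre', lintegral_prod _ (by fun_prop),
      ← compProd_map_condDistrib hV.aemeasurable, Measure.lintegral_compProd hf,
      Measure.lintegral_compProd (by fun_prop)]
    refine lintegral_congr_ae (hconst.mono fun w hw => ?_)
    simp only [Kernel.prod_apply, hw, Kernel.const_apply]
    rw [lintegral_prod_symm _ (by fun_prop)]
  have hjoint : (P.map fun ω => ((W ω, V ω), U ω)).map (fun p => (p.1.1, p.2, p.1.2)) =
      P.map fun ω => (W ω, U ω, V ω) := by
    rw [Measure.map_map hre' ((hW.prodMk hV).prodMk hU)]; rfl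
  rw [condMutualInfoNats, ← href, ← hjoint]
  refine le_antisymm (klDiv_map_le _ _ hre') ?_
  have hb := klDiv_map_le ((P.map fun ω => ((W ω, V ω), U ω)).map fun p => (p.1.1, p.2, p.1.2))
    (((P.map fun ω => (W ω, V ω)).prod (P.map U)).map fun p => (p.1.1, p.2, p.1.2)) hre
  rw [Measure.map_map hre hre', Measure.map_map hre hre'] at hb
  simpa [Function.comp_def] using hb

theorem indepFun_prod_of_indepFun {Ξ α' β' : Type*} [MeasurableSpace Ξ] [MeasurableSpace α']
    [MeasurableSpace β'] {S : Measure Ξ} [IsProbabilityMeasure S] {a : Ω → α} {b : Ω → β}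
    {a' : Ξ → α'} {b' : Ξ → β'} (ha : Measurable a) (hb : Measurable b) (ha' : Measurable a')
    (hb' : Measurable b') (h : IndepFun a b R) (h' : IndepFun a' b' S) :
    IndepFun (fun ω : Ω × Ξ => (a ω.1, a' ω.2)) (fun ω => (b ω.1, b' ω.2)) (R.prod S) := by
  have := Measure.isProbabilityMeasure_map (μ := R) ha.aemeasurable
  have := Measure.isProbabilityMeasure_map (μ := R) hb.aemeasurable
  have := Measure.isProbabilityMeasure_map (μ := S) ha'.aemeasurable
  have := Measure.isProbabilityMeasure_map (μ := S) hb'.aemeasurable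
  rw [indepFun_iff_map_prod_eq_prod_map_map (by fun_prop) (by fun_prop)]
  have e1 : (R.prod S).map (fun ω => (a ω.1, a' ω.2)) = (R.map a).prod (S.map a') :=
    (Measure.map_prod_map R S ha ha').symm
  have e2 : (R.prod S).map (fun ω => (b ω.1, b' ω.2)) = (R.map b).prod (S.map b') :=
    (Measure.map_prod_map R S hb hb').symm
  have h3 := (indepFun_iff_map_prod_eq_prod_map_map ha.aemeasurable hb.aemeasurable).1 h
  have h4 := (indepFun_iff_map_prod_eq_prod_map_map ha'.aemeasurable hb'.aemeasurable).1 h'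
  rw [e1, e2]
  refine Measure.ext_of_lintegral _ fun f hf => ?_
  rw [lintegral_map hf (by fun_prop), lintegral_prod _ (by fun_prop)]
  have inner : ∀ ω, ∫⁻ ξ, f ((a ω, a' ξ), (b ω, b' ξ)) ∂(S) =
      ∫⁻ p, f ((a ω, p.1), (b ω, p.2)) ∂((S.map a').prod (S.map b')) := fun ω => by
    rw [← h4, lintegral_map (by fun_prop) (by fun_prop)]
  have outer : ∫⁻ ω, ∫⁻ p, f ((a ω, p.1), (b ω, p.2)) ∂((S.map a').prod (S.map b')) ∂(R) =
      ∫⁻ q, ∫⁻ p, f ((q.1, p.1), (q.2, p.2)) ∂((S.map a').prod (S.map b'))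
        ∂((R.map a).prod (R.map b)) := by
    have hF : Measurable fun q : α × β => ∫⁻ p, f ((q.1, p.1), (q.2, p.2))
        ∂((S.map a').prod (S.map b')) :=
      Measurable.lintegral_prod_right'
        (f := fun z : (α × β) × α' × β' => f ((z.1.1, z.2.1), (z.1.2, z.2.2))) (by fun_prop)
    rw [← h3, lintegral_map hF (ha.prodMk hb)]
  simp only [inner]
  rw [outer, lintegral_prod _ (by fun_prop), lintegral_prod _ (by fun_prop),
    lintegral_prod _ (by fun_prop)]
  refine lintegral_congr fun x => ?_
  have : ∀ y, ∫⁻ p, f ((x, p.1), (y, p.2)) ∂((S.map a').prod (S.map b')) =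
      ∫⁻ x', ∫⁻ y', f ((x, x'), (y, y')) ∂(S.map b') ∂(S.map a') := fun y =>
    lintegral_prod _ (by fun_prop)
  simp only [this]
  rw [lintegral_lintegral_swap (by fun_prop)]
  refine lintegral_congr fun x' => ?_
  rw [lintegral_prod _ (by fun_prop)]

end Divergence

/-! ### Laws of inputs and outputs for independent inputs -/

namespace HDRelayNetwork

variable {N : ℕ} {X Y : Fin (N + 1) → Type*}
  [∀ i, MeasurableSpace (X i)] [∀ i, MeasurableSpace (Y i)]

/-- The inputs of the nodes in `T` together with the outputs of the nodes in `U`. -/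
def obs (T U : Finset (Fin (N + 1))) (xy : (∀ i, X i) × (∀ i, Y i)) :
    (∀ i : T, X i) × (∀ i : U, Y i) :=
  (T.restrict xy.1, U.restrict xy.2)

@[fun_prop]
theorem measurable_obs (T U : Finset (Fin (N + 1))) : Measurable (obs (X := X) (Y := Y) T U) := by
  unfold obs; fun_prop

variable (net : HDRelayNetwork N X Y) (q : ∀ i, ProbabilityMeasure (X i)) (s : RelayState N)

/-- The transition probability `P_{Y i | X, S = s}` of a single output. -/
noncomputable def outKernel (i : Fin (N + 1)) : Kernel (∀ i, X i) (Y i) :=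
  (net.trans.sectL s).map fun y => y i

instance (i : Fin (N + 1)) : IsMarkovKernel (net.outKernel s i) :=
  Kernel.IsMarkovKernel.map _ (measurable_pi_apply i)

theorem outKernel_apply (i : Fin (N + 1)) (x : ∀ i, X i) :
    net.outKernel s i x = (net.trans (x, s)).map fun y => y i := by
  rw [outKernel, Kernel.map_apply _ (measurable_pi_apply i), Kernel.sectL_apply]

/-- The law of the output `Y i` in state `s`, for independent inputs with marginals `q`. -/
noncomputable def outLaw (i : Fin (N + 1)) : Measure (Y i) :=
  (net.jointLaw q s).map fun xy => xy.2 i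

instance (i : Fin (N + 1)) : IsProbabilityMeasure (net.outLaw q s i) :=
  Measure.isProbabilityMeasure_map (by fun_prop)

/-- The reference law: all inputs and outputs independent, with the marginals they have under
`jointLaw`. -/
noncomputable def productLaw : Measure ((∀ i, X i) × (∀ i, Y i)) :=
  (Measure.pi fun i => (q i : Measure (X i))).prod (Measure.pi (net.outLaw q s))

instance : IsProbabilityMeasure (net.productLaw q s) := by
  unfold productLaw; infer_instance

/-- The relative entropy, in nats, of the joint law of the inputs in `T` and the outputs in `U` to
the product of their marginals (their total correlation). -/
noncomputable def nodeDiv (T U : Finset (Fin (N + 1))) : ℝ≥0∞ :=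
  klDiv ((net.jointLaw q s).map (obs T U)) ((net.productLaw q s).map (obs T U))

theorem lintegral_jointLaw {f : (∀ i, X i) × (∀ i, Y i) → ℝ≥0∞} (hf : Measurable f) :
    ∫⁻ xy, f xy ∂(net.jointLaw q s) =
      ∫⁻ x, ∫⁻ y, f (x, y) ∂(net.trans (x, s)) ∂(Measure.pi fun i => (q i : Measure (X i))) := by
  rw [jointLaw, Measure.lintegral_compProd hf]
  rfl

theorem jointLaw_map_fst :
    (net.jointLaw q s).map Prod.fst = Measure.pi fun i => (q i : Measure (X i)) :=
  Measure.fst_compProd _ _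

theorem productLaw_map_fst :
    (net.productLaw q s).map Prod.fst = Measure.pi fun i => (q i : Measure (X i)) := by
  rw [productLaw, Measure.map_fst_prod, measure_univ, one_smul]

theorem indepFun_inputs {T T' : Finset (Fin (N + 1))} (h : Disjoint T T') :
    IndepFun T.restrict T'.restrict (Measure.pi fun i => (q i : Measure (X i))) :=
  (iIndepFun_pi (μ := fun i => (q i : Measure (X i))) (X := fun _ => id)
    fun _ => aemeasurable_id).indepFun_finset T T' h fun i => measurable_pi_apply i

theorem indepFun_obs {T T' U U' : Finset (Fin (N + 1))} (hT : Disjoint T T')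
    (hU : Disjoint U U') : IndepFun (obs T U) (obs T' U') (net.productLaw q s) :=
  indepFun_prod_of_indepFun (by fun_prop) (by fun_prop) (by fun_prop) (by fun_prop)
    (indepFun_inputs q hT)
    ((iIndepFun_pi (μ := net.outLaw q s) (X := fun _ => id)
      fun _ => aemeasurable_id).indepFun_finset U U' hU fun i => measurable_pi_apply i)

theorem jointLaw_map_input_restrict (T : Finset (Fin (N + 1))) :
    (net.jointLaw q s).map (fun xy => T.restrict xy.1) =
      (net.productLaw q s).map fun xy => T.restrict xy.1 := by
  have h := (net.jointLaw_map_fst q s).trans (net.productLaw_map_fst q s).symm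
  have h' := congrArg (Measure.map T.restrict) h
  rwa [Measure.map_map (by fun_prop) measurable_fst,
    Measure.map_map (by fun_prop) measurable_fst] at h'

theorem indepFun_jointLaw_inputs {T T' : Finset (Fin (N + 1))} (h : Disjoint T T') :
    IndepFun (fun xy => T.restrict xy.1) (fun xy => T'.restrict xy.1) (net.jointLaw q s) := by
  have h' := indepFun_inputs q h
  rw [← net.jointLaw_map_fst q s, indepFun_iff_map_prod_eq_prod_map_map (by fun_prop)
    (by fun_prop), Measure.map_map (by fun_prop) measurable_fst,
    Measure.map_map (by fun_prop) measurable_fst,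
    Measure.map_map (by fun_prop) measurable_fst] at h'
  exact (indepFun_iff_map_prod_eq_prod_map_map (by fun_prop) (by fun_prop)).2 h'

/-- The half-duplex constraint: the law of a relay's output never depends on its own input, since
a listening relay sends nothing and a transmitting relay receives noise of a fixed law. -/
theorem outKernel_eq_of_agree (k : Fin N) {x x' : ∀ i, X i}
    (h : ∀ i, i ≠ k.castSucc → x i = x' i) :
    net.outKernel s k.castSucc x = net.outKernel s k.castSucc x' := by
  rw [outKernel_apply, outKernel_apply]
  cases hk : s k
  · rw [net.listen k s hk x x' h]
  · obtain ⟨ν, hν⟩ := net.transmit k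
    rw [(hν x s hk).1, (hν x' s hk).1]

/-! ### Total correlation of inputs and outputs -/

/-- Data processing: every statistic `V` from which the inputs in `T` and the outputs in `U` can be
read off has at least their divergence. -/
theorem nodeDiv_le {β : Type*} [MeasurableSpace β] {V : (∀ i, X i) × (∀ i, Y i) → β}
    (hV : Measurable V) {T U : Finset (Fin (N + 1))}
    (hT : ∀ i ∈ T, ∃ g : β → X i, Measurable g ∧ ∀ xy, g (V xy) = xy.1 i)
    (hU : ∀ i ∈ U, ∃ g : β → Y i, Measurable g ∧ ∀ xy, g (V xy) = xy.2 i) :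
    net.nodeDiv q s T U ≤
      klDiv ((net.jointLaw q s).map V) ((net.productLaw q s).map V) := by
  choose g hg hgV using fun i : T => hT i.1 i.2
  choose g' hg' hgV' using fun i : U => hU i.1 i.2
  have h := klDiv_map_comp_le (P := net.jointLaw q s) (R := net.productLaw q s) hV
    (g := fun z => ((fun i => g i z : ∀ i : T, X i), (fun i => g' i z : ∀ i : U, Y i)))
    (by fun_prop)
  simp only [hgV, hgV'] at h
  exact h

theorem nodeDiv_mono {T T' U U' : Finset (Fin (N + 1))} (hT : T ⊆ T') (hU : U ⊆ U') :
    net.nodeDiv q s T U ≤ net.nodeDiv q s T' U' :=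
  net.nodeDiv_le q s (measurable_obs T' U')
    (fun i hi => ⟨fun z => z.1 ⟨i, hT hi⟩, by fun_prop, fun _ => rfl⟩)
    (fun i hi => ⟨fun z => z.2 ⟨i, hU hi⟩, by fun_prop, fun _ => rfl⟩)

theorem klDiv_map_obs_prod (T T' U U' : Finset (Fin (N + 1))) :
    klDiv ((net.jointLaw q s).map fun xy => (obs T U xy, obs T' U' xy))
      ((net.productLaw q s).map fun xy => (obs T U xy, obs T' U' xy)) =
      net.nodeDiv q s (T ∪ T') (U ∪ U') := by
  refine le_antisymm ?_ (net.nodeDiv_le q s (by fun_prop) (fun i hi => ?_) fun i hi => ?_)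
  · exact klDiv_map_comp_le (measurable_obs (T ∪ T') (U ∪ U'))
      (g := fun z => ((Finset.restrict₂ Finset.subset_union_left z.1,
          Finset.restrict₂ Finset.subset_union_left z.2),
        (Finset.restrict₂ Finset.subset_union_right z.1,
          Finset.restrict₂ Finset.subset_union_right z.2))) (by fun_prop)
  · rcases Finset.mem_union.1 hi with hi | hi
    · exact ⟨fun z => z.1.1 ⟨i, hi⟩, by fun_prop, fun _ => rfl⟩
    · exact ⟨fun z => z.2.1 ⟨i, hi⟩, by fun_prop, fun _ => rfl⟩
  · rcases Finset.mem_union.1 hi with hi | hi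
    · exact ⟨fun z => z.1.2 ⟨i, hi⟩, by fun_prop, fun _ => rfl⟩
    · exact ⟨fun z => z.2.2 ⟨i, hi⟩, by fun_prop, fun _ => rfl⟩

section IndependentNoises

theorem nodeDiv_univ_empty : net.nodeDiv q s Finset.univ ∅ = 0 := by
  have h := net.nodeDiv_le q s (T := Finset.univ) (U := ∅) (V := Prod.fst) measurable_fst
    (fun i _ => ⟨fun x => x i, by fun_prop, fun _ => rfl⟩) (by simp)
  rw [jointLaw_map_fst, productLaw_map_fst, klDiv_self] at h
  exact le_antisymm h zero_le

variable [∀ i, StandardBorelSpace (Y i)] [∀ i, Nonempty (Y i)]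

/-- Given all inputs, the outputs are conditionally independent, so each adds its own
divergence. -/
theorem nodeDiv_univ_insert (hnoise : net.IndependentNoises) {U : Finset (Fin (N + 1))}
    {i : Fin (N + 1)} (hi : i ∉ U) :
    net.nodeDiv q s Finset.univ (insert i U) =
      net.nodeDiv q s Finset.univ U + net.nodeDiv q s Finset.univ {i} := by
  have hout : ∀ x, (net.trans (x, s)).map (fun y => (U.restrict y, y i)) =
      ((net.trans (x, s)).map U.restrict).prod (net.outKernel s i x) := fun x => by
    have := fun i => Measure.isProbabilityMeasure_map (μ := net.trans (x, s))
      (measurable_pi_apply i).aemeasurable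
    have h := (iIndepFun_pi (μ := fun i => (net.trans (x, s)).map fun y => y i)
      (X := fun _ => id) fun _ => aemeasurable_id).indepFun_finset U {i}
      (Finset.disjoint_singleton_right.2 hi) fun i => measurable_pi_apply i
    rw [← hnoise x s] at h
    have hψ : Measurable fun z : (∀ j : ({i} : Finset (Fin (N + 1))), Y j) =>
        z ⟨i, Finset.mem_singleton_self i⟩ := measurable_pi_apply _
    have h' : IndepFun U.restrict (fun y : ∀ i, Y i => y i) (net.trans (x, s)) :=
      h.comp (φ := id) measurable_id hψ
    rw [outKernel_apply]
    exact (indepFun_iff_map_prod_eq_prod_map_map (by fun_prop)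
      (measurable_pi_apply i).aemeasurable).1 h'
  have hP : (net.jointLaw q s).map (fun xy => ((xy.1, U.restrict xy.2), xy.2 i)) =
      (net.jointLaw q s).map (fun xy => (xy.1, U.restrict xy.2)) ⊗ₘ
        (net.outKernel s i).prodMkRight (∀ i : U, Y i) := by
    refine Measure.ext_of_lintegral _ fun f hf => ?_
    have hF := hf.lintegral_kernel_prod_right'
      (κ := (net.outKernel s i).prodMkRight (∀ i : U, Y i))
    have hF' := hF.comp (f := fun xy : (∀ i, X i) × (∀ i, Y i) => (xy.1, U.restrict xy.2))
      (by fun_prop)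
    rw [lintegral_map hf (by fun_prop), Measure.lintegral_compProd hf,
      lintegral_map hF (by fun_prop)]
    refine (lintegral_jointLaw net q s (by fun_prop)).trans
      (Eq.trans ?_ (lintegral_jointLaw net q s hF').symm)
    refine lintegral_congr fun x => ?_
    have h1 : ∫⁻ y, f ((x, U.restrict y), y i) ∂(net.trans (x, s)) =
        ∫⁻ p, f ((x, p.1), p.2) ∂((net.trans (x, s)).map fun y => (U.restrict y, y i)) := by
      rw [lintegral_map (by fun_prop) (by fun_prop)]
    simp only [Function.comp_apply, Kernel.prodMkRight_apply]
    rw [h1, hout, lintegral_prod _ (by fun_prop)]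
    exact lintegral_map (hF.comp (measurable_prodMk_left (x := x))) (by fun_prop)
  have hind : IndepFun (fun xy => (xy.1, U.restrict xy.2)) (fun xy => xy.2 i)
      (net.productLaw q s) :=
    (net.indepFun_obs q s (T := Finset.univ) (T' := ∅) (U := U) (U' := {i})
      (Finset.disjoint_empty_right _) (Finset.disjoint_singleton_right.2 hi)).comp
      (φ := fun z => (fun i => z.1 ⟨i, Finset.mem_univ i⟩, z.2))
      (ψ := fun z => z.2 ⟨i, Finset.mem_singleton_self i⟩) (by fun_prop) (by fun_prop)
  have hadd := klDiv_map_add_of_compProd measurable_fst (V₂ := fun xy => U.restrict xy.2)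
    (by fun_prop) (by fun_prop) _ hP hind
    ((net.jointLaw_map_fst q s).trans (net.productLaw_map_fst q s).symm)
  have e1 : klDiv ((net.jointLaw q s).map fun xy => ((xy.1, U.restrict xy.2), xy.2 i))
      ((net.productLaw q s).map fun xy => ((xy.1, U.restrict xy.2), xy.2 i)) =
      net.nodeDiv q s Finset.univ (insert i U) := by
    refine le_antisymm ?_ (net.nodeDiv_le q s (by fun_prop) (fun j _ => ?_) fun j hj => ?_)
    · exact klDiv_map_comp_le (measurable_obs Finset.univ (insert i U))
        (g := fun z => ((fun j => z.1 ⟨j, Finset.mem_univ j⟩,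
          Finset.restrict₂ (Finset.subset_insert i U) z.2),
          z.2 ⟨i, Finset.mem_insert_self i U⟩)) (by fun_prop)
    · exact ⟨fun z => z.1.1 j, by fun_prop, fun _ => rfl⟩
    · rcases Finset.mem_insert.1 hj with rfl | hj
      · exact ⟨Prod.snd, measurable_snd, fun _ => rfl⟩
      · exact ⟨fun z => z.1.2 ⟨j, hj⟩, by fun_prop, fun _ => rfl⟩
  have e2 : klDiv ((net.jointLaw q s).map fun xy => (xy.1, U.restrict xy.2))
      ((net.productLaw q s).map fun xy => (xy.1, U.restrict xy.2)) =
      net.nodeDiv q s Finset.univ U := by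
    refine le_antisymm ?_ (net.nodeDiv_le q s (by fun_prop) (fun j _ => ?_) fun j hj => ?_)
    · exact klDiv_map_comp_le (measurable_obs Finset.univ U)
        (g := fun z => (fun j => z.1 ⟨j, Finset.mem_univ j⟩, z.2)) (by fun_prop)
    · exact ⟨fun z => z.1 j, by fun_prop, fun _ => rfl⟩
    · exact ⟨fun z => z.2 ⟨j, hj⟩, by fun_prop, fun _ => rfl⟩
  have e3 : klDiv ((net.jointLaw q s).map fun xy => (xy.1, xy.2 i))
      ((net.productLaw q s).map fun xy => (xy.1, xy.2 i)) =
      net.nodeDiv q s Finset.univ {i} := by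
    refine le_antisymm ?_ (net.nodeDiv_le q s (by fun_prop) (fun j _ => ?_) fun j hj => ?_)
    · exact klDiv_map_comp_le (measurable_obs Finset.univ {i})
        (g := fun z => (fun j => z.1 ⟨j, Finset.mem_univ j⟩,
          z.2 ⟨i, Finset.mem_singleton_self i⟩)) (by fun_prop)
    · exact ⟨fun z => z.1 j, by fun_prop, fun _ => rfl⟩
    · rw [Finset.mem_singleton] at hj
      subst hj
      exact ⟨Prod.snd, measurable_snd, fun _ => rfl⟩
  rw [← e1, ← e2, ← e3]
  exact hadd

theorem nodeDiv_univ_eq_sum (hnoise : net.IndependentNoises) (U : Finset (Fin (N + 1))) :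
    net.nodeDiv q s Finset.univ U = ∑ i ∈ U, net.nodeDiv q s Finset.univ {i} := by
  induction U using Finset.induction_on with
  | empty => simp [nodeDiv_univ_empty]
  | insert i U hi ih =>
    rw [net.nodeDiv_univ_insert q s hnoise hi, Finset.sum_insert hi, ih, add_comm]

end IndependentNoises

/-- The mutual information, in nats, between the inputs outside `T` and the pair of the inputs in
`T` and the outputs in `U`. -/
noncomputable def flow (T U : Finset (Fin (N + 1))) : ℝ≥0∞ :=
  klDiv ((net.jointLaw q s).map fun xy => (obs T U xy, Tᶜ.restrict xy.1))
    (((net.jointLaw q s).map (obs T U)).prod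
      ((net.jointLaw q s).map fun xy => Tᶜ.restrict xy.1))

theorem flow_mono (T : Finset (Fin (N + 1))) {U U' : Finset (Fin (N + 1))} (h : U ⊆ U') :
    net.flow q s T U ≤ net.flow q s T U' := by
  have : IsProbabilityMeasure ((net.jointLaw q s).map fun xy => Tᶜ.restrict xy.1) :=
    Measure.isProbabilityMeasure_map (by fun_prop)
  exact klDiv_map_prodMk_prod_le (measurable_obs T U') (by fun_prop)
    (g := fun z => (z.1, Finset.restrict₂ h z.2)) (by fun_prop) _

variable [∀ i, Nonempty (X i)]

/-- For independent inputs, the input and the output of the same relay are independent. -/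
theorem jointLaw_map_own_eq (k : Fin N) :
    (net.jointLaw q s).map (fun xy => (xy.1 k.castSucc, xy.2 k.castSucc)) =
      (net.productLaw q s).map fun xy => (xy.1 k.castSucc, xy.2 k.castSucc) := by
  classical
  have hR : (net.productLaw q s).map (fun xy => (xy.1 k.castSucc, xy.2 k.castSucc)) =
      (q k.castSucc : Measure (X k.castSucc)).prod (net.outLaw q s k.castSucc) := by
    have h := Measure.map_prod_map (Measure.pi fun i => (q i : Measure (X i)))
      (Measure.pi (net.outLaw q s)) (measurable_pi_apply k.castSucc)
      (measurable_pi_apply k.castSucc)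
    rw [(measurePreserving_eval _ k.castSucc).map_eq,
      (measurePreserving_eval _ k.castSucc).map_eq] at h
    exact h.symm
  rw [hR]
  refine (Measure.prod_eq fun B C hB hC => ?_).symm
  set π := Measure.pi fun i => (q i : Measure (X i)) with hπ
  have hout : net.outLaw q s k.castSucc C = ∫⁻ x, net.outKernel s k.castSucc x C ∂π := by
    rw [outLaw, Measure.map_apply (by fun_prop) hC, jointLaw,
      Measure.compProd_apply (hC.preimage (by fun_prop))]
    refine lintegral_congr fun x => ?_
    rw [outKernel_apply, Measure.map_apply (measurable_pi_apply _) hC]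
    rfl
  have hq : (q k.castSucc : Measure (X k.castSucc)) B =
      ∫⁻ x, B.indicator 1 (x k.castSucc) ∂π := by
    rw [← lintegral_map (f := B.indicator 1) (measurable_one.indicator hB)
      (measurable_pi_apply _), (measurePreserving_eval _ k.castSucc).map_eq,
      lintegral_indicator_one hB]
  have hjoint : (net.jointLaw q s).map (fun xy => (xy.1 k.castSucc, xy.2 k.castSucc)) (B ×ˢ C) =
      ∫⁻ x, B.indicator 1 (x k.castSucc) * net.outKernel s k.castSucc x C ∂π := by
    rw [Measure.map_apply (by fun_prop) (hB.prod hC), jointLaw,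
      Measure.compProd_apply ((hB.prod hC).preimage (by fun_prop))]
    refine lintegral_congr fun x => ?_
    rw [outKernel_apply, Measure.map_apply (measurable_pi_apply _) hC, Kernel.sectL_apply]
    by_cases hx : x k.castSucc ∈ B
    · simp only [Set.indicator_of_mem hx, Pi.one_apply, one_mul]
      congr 1
      ext y
      simp [hx]
    · simp only [Set.indicator_of_notMem hx, zero_mul]
      convert measure_empty (μ := net.trans (x, s))
      ext y
      simp [hx]
  -- the law of the output is a function of the inputs of the other nodes
  let fill : (∀ i : ({k.castSucc}ᶜ : Finset (Fin (N + 1))), X i) → ∀ i, X i := fun z i =>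
    if h : i ∈ ({k.castSucc}ᶜ : Finset (Fin (N + 1))) then z ⟨i, h⟩ else Classical.arbitrary _
  have hfill : Measurable fill := measurable_pi_lambda _ fun i => by
    by_cases h : i ∈ ({k.castSucc}ᶜ : Finset (Fin (N + 1)))
    · simp only [fill, h, dif_pos]; fun_prop
    · simp only [fill, h, dif_neg, not_false_eq_true]; fun_prop
  have hker : ∀ x, net.outKernel s k.castSucc x =
      net.outKernel s k.castSucc (fill (Finset.restrict _ x)) := fun x =>
    net.outKernel_eq_of_agree s k fun i hi => by simp [fill, hi]
  have hind : IndepFun (fun x : ∀ i, X i => B.indicator (1 : X k.castSucc → ℝ≥0∞) (x k.castSucc))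
      (fun x => net.outKernel s k.castSucc x C) π := by
    have h := (indepFun_inputs q (T := {k.castSucc}) (T' := {k.castSucc}ᶜ)
      disjoint_compl_right).comp
      (φ := B.indicator (1 : X k.castSucc → ℝ≥0∞) ∘
        fun z => z ⟨k.castSucc, Finset.mem_singleton_self _⟩)
      (ψ := fun z => net.outKernel s k.castSucc (fill z) C)
      ((measurable_one.indicator hB).comp (measurable_pi_apply
        (⟨k.castSucc, Finset.mem_singleton_self _⟩ : ({k.castSucc} : Finset (Fin (N + 1))))))
      ((Kernel.measurable_coe _ hC).comp hfill)
    have e : (fun x => net.outKernel s k.castSucc x C) =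
        (fun z => net.outKernel s k.castSucc (fill z) C) ∘ Finset.restrict _ :=
      funext fun x => by rw [hker x]; rfl
    rw [e]
    exact h
  rw [hjoint, hq, hout]
  exact lintegral_mul_eq_lintegral_mul_lintegral_of_indepFun
    ((measurable_one.indicator hB).comp (measurable_pi_apply _)) (Kernel.measurable_coe _ hC) hind

variable [∀ i, StandardBorelSpace (X i)]

theorem nodeDiv_add_flow (T U : Finset (Fin (N + 1))) :
    net.nodeDiv q s T U + net.flow q s T U = net.nodeDiv q s Finset.univ U := by
  have hind : IndepFun (obs T U) (fun xy => Tᶜ.restrict xy.1) (net.productLaw q s) :=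
    (net.indepFun_obs q s (T := T) (T' := Tᶜ) (U := U) (U' := ∅)
      disjoint_compl_right (Finset.disjoint_empty_right _)).comp
      (φ := id) (ψ := Prod.fst) measurable_id measurable_fst
  have h := klDiv_map_prodMk_of_indepFun (P := net.jointLaw q s) (measurable_obs T U)
    (by fun_prop) hind
  rw [← jointLaw_map_input_restrict] at h
  refine h.symm.trans (le_antisymm ?_
    (net.nodeDiv_le q s (by fun_prop) (fun j _ => ?_) fun j hj => ?_))
  · exact klDiv_map_comp_le (measurable_obs Finset.univ U)
      (g := fun z => ((Finset.restrict₂ (Finset.subset_univ T) z.1, z.2),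
        Finset.restrict₂ (Finset.subset_univ Tᶜ) z.1)) (by fun_prop)
  · by_cases hj : j ∈ T
    · exact ⟨fun z => z.1.1 ⟨j, hj⟩, by fun_prop, fun _ => rfl⟩
    · exact ⟨fun z => z.2 ⟨j, Finset.mem_compl.2 hj⟩, by fun_prop, fun _ => rfl⟩
  · exact ⟨fun z => z.1.2 ⟨j, hj⟩, by fun_prop, fun _ => rfl⟩

variable [∀ i, StandardBorelSpace (Y i)] [∀ i, Nonempty (Y i)]

theorem nodeDiv_supermodular (T T' U U' : Finset (Fin (N + 1))) :
    net.nodeDiv q s T U + net.nodeDiv q s T' U' ≤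
      net.nodeDiv q s (T ∪ T') (U ∪ U') + net.nodeDiv q s (T ∩ T') (U ∩ U') := by
  have hind : IndepFun (fun xy => (obs (T ∩ T') (U ∩ U') xy, obs T U xy))
      (obs (T' \ T) (U' \ U)) (net.productLaw q s) :=
    (net.indepFun_obs q s (T := T) (T' := T' \ T) (U := U) (U' := U' \ U)
      Finset.disjoint_sdiff Finset.disjoint_sdiff).comp
      (φ := fun z => ((Finset.restrict₂ (Finset.inter_subset_left (s₂ := T')) z.1,
        Finset.restrict₂ (Finset.inter_subset_left (s₂ := U')) z.2), z)) (ψ := id)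
      (by fun_prop) measurable_id
  have hsup := klDiv_supermodular (P := net.jointLaw q s) (measurable_obs (T ∩ T') (U ∩ U'))
    (measurable_obs T U) (measurable_obs (T' \ T) (U' \ U)) hind
  have h3 : klDiv ((net.jointLaw q s).map fun xy =>
        ((obs (T ∩ T') (U ∩ U') xy, obs T U xy), obs (T' \ T) (U' \ U) xy))
      ((net.productLaw q s).map fun xy =>
        ((obs (T ∩ T') (U ∩ U') xy, obs T U xy), obs (T' \ T) (U' \ U) xy)) ≤
      net.nodeDiv q s (T ∪ T') (U ∪ U') :=
    klDiv_map_comp_le (measurable_obs (T ∪ T') (U ∪ U'))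
      (g := fun z => (((Finset.restrict₂
            (Finset.inter_subset_left.trans Finset.subset_union_left) z.1,
          Finset.restrict₂ (Finset.inter_subset_left.trans Finset.subset_union_left) z.2),
        (Finset.restrict₂ Finset.subset_union_left z.1,
          Finset.restrict₂ Finset.subset_union_left z.2)),
        (Finset.restrict₂ (Finset.sdiff_subset.trans Finset.subset_union_right) z.1,
          Finset.restrict₂ (Finset.sdiff_subset.trans Finset.subset_union_right) z.2)))
      (by fun_prop)
  rw [klDiv_map_obs_prod, klDiv_map_obs_prod] at hsup
  refine (add_le_add ?_ ?_).trans (hsup.trans (add_le_add h3 le_rfl))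
  · exact net.nodeDiv_mono q s Finset.subset_union_right Finset.subset_union_right
  · exact net.nodeDiv_mono q s (fun i hi => by by_cases h : i ∈ T <;> simp [h, hi])
      (fun i hi => by by_cases h : i ∈ U <;> simp [h, hi])

/-! ### Submodularity of the cut values -/

theorem cutInfo_eq_flow_div (A : Finset (Fin N)) :
    net.cutInfo q s A = net.flow q s (relayNodes A) (insert (Fin.last N) (relayNodes A)) /
      ENNReal.ofReal (Real.log 2) := by
  rw [cutInfo, condMutualInfo, condMutualInfoNats_of_indepFun (by fun_prop) (by fun_prop)
    (by fun_prop) (net.indepFun_jointLaw_inputs q s disjoint_compl_right)]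
  rfl

theorem flow_ne_top (hfin : ∀ A, net.cutInfo q s A ≠ ∞) (A : Finset (Fin N)) :
    net.flow q s (relayNodes A) (insert (Fin.last N) (relayNodes A)) ≠ ∞ := fun h => by
  refine hfin A ?_
  rw [cutInfo_eq_flow_div, h, ENNReal.top_div_of_ne_top ENNReal.ofReal_ne_top]

/-- The divergence of one output jointly with all inputs is finite: a relay's own input
contributes nothing, and the other inputs contribute at most the value of the cut `{k}`, or of the
empty cut for the destination. -/
theorem nodeDiv_univ_singleton_ne_top (hfin : ∀ A, net.cutInfo q s A ≠ ∞) (i : Fin (N + 1)) :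
    net.nodeDiv q s Finset.univ {i} ≠ ∞ := by
  induction i using Fin.lastCases with
  | last =>
    have h := net.nodeDiv_le q s (T := ∅) (U := {Fin.last N})
      (V := fun xy => xy.2 (Fin.last N)) (by fun_prop) (by simp) fun j hj => by
        rw [Finset.mem_singleton] at hj
        subst hj
        exact ⟨id, measurable_id, fun _ => rfl⟩
    have hR : (net.productLaw q s).map (fun xy => xy.2 (Fin.last N)) =
        net.outLaw q s (Fin.last N) := by
      have h := (measurePreserving_eval (net.outLaw q s) (Fin.last N)).comp
        (measurePreserving_snd (μ := Measure.pi fun i => (q i : Measure (X i)))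
          (ν := Measure.pi (net.outLaw q s)))
      exact h.map_eq
    rw [hR, ← outLaw, klDiv_self] at h
    have h0 : net.nodeDiv q s ∅ {Fin.last N} = 0 := le_antisymm h zero_le
    rw [← nodeDiv_add_flow net q s ∅, h0, zero_add]
    exact net.flow_ne_top q s hfin ∅
  | cast k =>
    have h := net.nodeDiv_le q s (T := {k.castSucc}) (U := {k.castSucc})
      (V := fun xy => (xy.1 k.castSucc, xy.2 k.castSucc)) (by fun_prop)
      (fun j hj => by
        rw [Finset.mem_singleton] at hj
        subst hj
        exact ⟨Prod.fst, measurable_fst, fun _ => rfl⟩)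
      (fun j hj => by
        rw [Finset.mem_singleton] at hj
        subst hj
        exact ⟨Prod.snd, measurable_snd, fun _ => rfl⟩)
    have : IsProbabilityMeasure ((net.productLaw q s).map fun xy =>
      (xy.1 k.castSucc, xy.2 k.castSucc)) := Measure.isProbabilityMeasure_map (by fun_prop)
    rw [jointLaw_map_own_eq, klDiv_self] at h
    have h0 : net.nodeDiv q s {k.castSucc} {k.castSucc} = 0 := le_antisymm h zero_le
    rw [← nodeDiv_add_flow net q s {k.castSucc}, h0, zero_add]
    exact ne_top_of_le_ne_top (net.flow_ne_top q s hfin {k})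
      (net.flow_mono q s _ (Finset.subset_insert _ _))

/-- Cut values are submodular: `f_s(A) log 2` is the modular function `∑ I(X; Y i)`, `i` ranging
over the receiving nodes of the cut, minus a supermodular divergence. -/
theorem cutInfo_submodular (hnoise : net.IndependentNoises)
    (hfin : ∀ A, net.cutInfo q s A ≠ ∞) (A B : Finset (Fin N)) :
    (net.cutInfo q s (A ∪ B)).toReal + (net.cutInfo q s (A ∩ B)).toReal ≤
      (net.cutInfo q s A).toReal + (net.cutInfo q s B).toReal := by
  set d : Finset (Fin N) → ℝ≥0∞ := fun A =>
    net.nodeDiv q s (relayNodes A) (insert (Fin.last N) (relayNodes A)) with hd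
  set e : Fin (N + 1) → ℝ≥0∞ := fun i => net.nodeDiv q s Finset.univ {i} with he
  set l : ℝ := Real.log 2 with hl
  have hl0 : 0 < l := Real.log_pos one_lt_two
  have hee : ∀ i, e i ≠ ∞ := net.nodeDiv_univ_singleton_ne_top q s hfin
  have hsum : ∀ A, d A + net.flow q s (relayNodes A) (insert (Fin.last N) (relayNodes A)) =
      ∑ i ∈ insert (Fin.last N) (relayNodes A), e i := fun A =>
    (net.nodeDiv_add_flow q s _ _).trans (net.nodeDiv_univ_eq_sum q s hnoise _)
  have hdt : ∀ A, d A ≠ ∞ := fun A =>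
    ne_top_of_le_ne_top (ENNReal.sum_ne_top.2 fun i _ => hee i) (le_self_add.trans (hsum A).le)
  have hreal : ∀ A, (net.cutInfo q s A).toReal * l =
      ∑ i ∈ insert (Fin.last N) (relayNodes A), (e i).toReal - (d A).toReal := fun A => by
    rw [cutInfo_eq_flow_div, ENNReal.toReal_div, ENNReal.toReal_ofReal hl0.le,
      div_mul_cancel₀ _ hl0.ne', ← ENNReal.toReal_sum fun i _ => hee i, ← hsum,
      ENNReal.toReal_add (hdt A) (net.flow_ne_top q s hfin A), add_sub_cancel_left]
  have hun : insert (Fin.last N) (relayNodes A) ∪ insert (Fin.last N) (relayNodes B) =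
      insert (Fin.last N) (relayNodes (A ∪ B)) := by
    rw [relayNodes, relayNodes, relayNodes, Finset.map_union, Finset.insert_union_distrib]
  have hin : insert (Fin.last N) (relayNodes A) ∩ insert (Fin.last N) (relayNodes B) =
      insert (Fin.last N) (relayNodes (A ∩ B)) := by
    rw [relayNodes, relayNodes, relayNodes, Finset.map_inter, Finset.insert_inter_distrib]
  have hsup : d A + d B ≤ d (A ∪ B) + d (A ∩ B) := by
    have h := net.nodeDiv_supermodular q s (relayNodes A) (relayNodes B)
      (insert (Fin.last N) (relayNodes A)) (insert (Fin.last N) (relayNodes B))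
    rw [hun, hin] at h
    simpa only [hd, relayNodes, Finset.map_union, Finset.map_inter] using h
  have hsup' := ENNReal.toReal_mono (ENNReal.add_ne_top.2 ⟨hdt _, hdt _⟩) hsup
  rw [ENNReal.toReal_add (hdt _) (hdt _), ENNReal.toReal_add (hdt _) (hdt _)] at hsup'
  have hmod := Finset.sum_union_inter (s₁ := insert (Fin.last N) (relayNodes A))
    (s₂ := insert (Fin.last N) (relayNodes B)) (f := fun i => (e i).toReal)
  rw [hun, hin] at hmod
  refine le_of_mul_le_mul_right ?_ hl0
  rw [add_mul, add_mul, hreal, hreal, hreal, hreal]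
  linarith

end HDRelayNetwork

/-! ### Sparse optimal schedules -/

theorem theorem1 {N : ℕ} {X Y : Fin (N + 1) → Type*}
    [∀ i, MeasurableSpace (X i)] [∀ i, StandardBorelSpace (X i)] [∀ i, Nonempty (X i)]
    [∀ i, MeasurableSpace (Y i)] [∀ i, StandardBorelSpace (Y i)] [∀ i, Nonempty (Y i)]
    (net : HDRelayNetwork N X Y)
    -- the noises are independent
    (hnoise : net.IndependentNoises)
    -- independent inputs: `p lam s i` is the law of the input of node `i` given the state `s`
    (p : Schedule N → RelayState N → ∀ i, ProbabilityMeasure (X i))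
    -- the cut values `f_s(A)` are finite
    (hfin : ∀ lam s A, net.cutInfo (p lam s) s A ≠ ∞)
    -- the cut values `f_s(A)` are not a function of the schedule
    (hsched : ∀ lam lam' s A, net.cutInfo (p lam s) s A = net.cutInfo (p lam' s) s A) :
    -- some schedule with at most `N + 1` active states attains `C' = max_λ min_A ∑_s λ_s f_s(A)`
    ∃ lamOpt : Schedule N,
      lamOpt.numActive ≤ N + 1 ∧
      IsGreatest (Set.range (net.minCut p)) (net.minCut p lamOpt) ∧
      -- if `C'` gives the capacity to within `G₁` and `G₂`, then so does that schedule
      ∀ G₁ G₂ : ℝ, 0 ≤ G₁ → 0 ≤ G₂ →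
        ((sSup (Set.range (net.minCut p)) - G₁ : ℝ) : EReal) ≤ net.capacity →
        net.capacity ≤ ((sSup (Set.range (net.minCut p)) + G₂ : ℝ) : EReal) →
        ((net.minCut p lamOpt - G₁ : ℝ) : EReal) ≤ net.capacity ∧
        net.capacity ≤ ((net.minCut p lamOpt + G₂ : ℝ) : EReal) := by
  obtain ⟨lam₀⟩ : Nonempty (Schedule N) := inferInstance
  set f : RelayState N → Finset (Fin N) → ℝ := fun s A =>
    (net.cutInfo (p lam₀ s) s A).toReal with hf
  have hmin : ∀ lam : Schedule N, net.minCut p lam =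
      Finset.univ.inf' Finset.univ_nonempty fun A => ∑ s, lam.1 s * f s A := fun lam => by
    simp only [HDRelayNetwork.minCut, hf, hsched lam lam₀]
  obtain ⟨lam, hlam, hcard, hopt⟩ := exists_sparse_maximin_of_submodular f
    (fun s A => ENNReal.toReal_nonneg)
    fun s A B => net.cutInfo_submodular (p lam₀ s) s hnoise (hfin lam₀ s) A B
  have hgreat : IsGreatest (Set.range (net.minCut p)) (net.minCut p ⟨lam, hlam⟩) := by
    refine ⟨⟨_, rfl⟩, ?_⟩
    rintro _ ⟨mu, rfl⟩
    rw [hmin, hmin]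
    exact hopt mu.1 mu.2
  refine ⟨⟨lam, hlam⟩, by simpa [Schedule.numActive] using hcard, hgreat,
    fun G₁ G₂ _ _ h₁ h₂ => ?_⟩
  rw [hgreat.csSup_eq] at h₁ h₂
  exact ⟨h₁, h₂⟩
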